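/- Notation. For a Lévy process $\mathbf X=(X_t)_{t\ge 0}$ in $\mathbb R^d$ started at $0$ and an open set $\Omega\subset\mathbb R^d$ with $|\Omega|<\infty$, the spectral heat content is $$Q_\Omega^{\mathbf X}(t)=\int_\Omega \mathbb P(\tau^x_\Omega>t)\,dx,\qquad \tau^x_\Omega=\inf\{s>0:\ x+X_s\notin\Omega\}.$$ $\mathbf X$ has Lévy triplet $(A,\gamma,\nu)$ if $A$ is a symmetric non-negative definite $d\times d$ matrix, $\gamma\in\mathbb R^d$, $\nu$ is a Borel measure on $\mathbb R^d$ with $\nu(\{0\})=0$ and $\int\min\{1,\|y\|^2\}\,\nu(dy)<\infty$, and $\mathbb E e^{i\langle\xi,X_t\rangle}=e^{-t\psi(\xi)}$ with $$\psi(\xi)=\langle\xi,A\xi\rangle-i\langle\xi,\gamma\rangle-\int_{\mathbb R^d}\bigl(e^{i\langle\xi,y\rangle}-1-i\langle\xi,y\rangle 1_{\{\|y\|\le1\}}\bigr)\,\nu(dy).$$ Theorem. Let $\Omega\subset\mathbb R^d$ be open with $|\Omega|<\infty$. Let $\mathbf Y$ and $\mathbf X$ be Lévy processes in $\mathbb R^d$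 with triplets $(A,\gamma^{\mathbf Y},\nu^{\mathbf Y})$ and $(A,\gamma^{\mathbf X},\nu)$, such that $\sigma=\nu-\nu^{\mathbf Y}$ is a signed measure of finite total variation and $\mathbf X$ and $\mathbf Y$ have the same drift, in the sense that $$\gamma^{\mathbf X}-\gamma^{\mathbf Y}=\int_{\|y\|\le 1}y\,\sigma(dy)$$ (equivalently, $\psi^{\mathbf X}(\xi)-\psi^{\mathbf Y}(\xi)=\int(1-e^{i\langle\xi,y\rangle})\,\sigma(dy)$; when $\int_{\|y\|\le1}y\,\sigma(dy)=0$, for instance when $\sigma$ is symmetric, this says $\gamma^{\mathbf X}=\gamma^{\mathbf Y}$). Let $f$ be a real function that is nonzero for all small $t>0$ and satisfies $\lim_{t\to0+}t/f(t)=0$, and suppose that $$\lim_{t\to0+}\frac{|\Omega|-Q_\Omega^{\mathbf Y}(t)}{f(t)}=C\in[-\infty,\infty].$$ Then $\lim_{t\to0+}\dfrac{|\Omega|-Q_\Omega^{\mathbf X}(t)}{f(t)}$ exists and equals $C$. -/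

import Mathlib

open MeasureTheory ProbabilityTheory Filter Topology
open scoped NNReal ENNReal

/-- `ν` is a Lévy measure on `ℝ^d`: no mass at the origin, and `∫ min (1, ‖y‖²) ν(dy) < ∞`. -/
def IsLevyMeasure {d : ℕ} (ν : Measure (EuclideanSpace ℝ (Fin d))) : Prop :=
  ν {0} = 0 ∧ ∫⁻ y, ENNReal.ofReal (min 1 (‖y‖ ^ 2)) ∂ν < ∞

/-- The characteristic exponent of the triplet `(A, γ, ν)`,
`ψ(ξ) = ⟨ξ, A ξ⟩ - i ⟨ξ, γ⟩ - ∫ (e^{i⟨ξ, y⟩} - 1 - i ⟨ξ, y⟩ 1_{‖y‖ ≤ 1}) ν(dy)`. -/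
noncomputable def levyExponent {d : ℕ} (A : Matrix (Fin d) (Fin d) ℝ)
    (γ : EuclideanSpace ℝ (Fin d)) (ν : Measure (EuclideanSpace ℝ (Fin d)))
    (ξ : EuclideanSpace ℝ (Fin d)) : ℂ :=
  (inner ℝ ξ (A.toEuclideanLin ξ) : ℝ) - Complex.I * (inner ℝ ξ γ : ℝ)
    - ∫ y, (Complex.exp (Complex.I * (inner ℝ ξ y : ℝ)) - 1
        - Complex.I * (if ‖y‖ ≤ 1 then (inner ℝ ξ y : ℝ) else 0 : ℝ)) ∂ν

/-- `X = (X_t)_{t ≥ 0}` is a Lévy process in `ℝ^d`, started at `0`, on the probability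
space `(S, P)`. -/
structure IsLevyProcess {d : ℕ} {S : Type*} [MeasurableSpace S]
    (X : ℝ≥0 → S → EuclideanSpace ℝ (Fin d)) (P : Measure S) : Prop where
  measurable : ∀ t, Measurable (X t)
  start_zero : ∀ᵐ ω ∂P, X 0 ω = 0
  indep_increments : HasIndepIncrements X P
  stationary_increments : ∀ s t, IdentDistrib (fun ω ↦ X (s + t) ω - X s ω) (X t) P P
  stochastic_continuity : ∀ t, TendstoInMeasure P X (𝓝 t) (X t)
  rightCts_leftLim : ∀ᵐ ω ∂P, ∀ t : ℝ≥0,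
    ContinuousWithinAt (fun s ↦ X s ω) (Set.Ici t) t ∧
      ∃ l, Tendsto (fun s ↦ X s ω) (𝓝[<] t) (𝓝 l)

/-- `X` is a Lévy process with Lévy triplet `(A, γ, ν)`: `A` is symmetric and non-negative
definite, `ν` is a Lévy measure, and `E e^{i⟨ξ, X_t⟩} = e^{-t ψ(ξ)}`. -/
structure IsLevyProcessWithTriplet {d : ℕ} {S : Type*} [MeasurableSpace S]
    (X : ℝ≥0 → S → EuclideanSpace ℝ (Fin d)) (P : Measure S)
    (A : Matrix (Fin d) (Fin d) ℝ) (γ : EuclideanSpace ℝ (Fin d))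
    (ν : Measure (EuclideanSpace ℝ (Fin d))) : Prop where
  isLevyProcess : IsLevyProcess X P
  posSemidef : A.PosSemidef
  isLevyMeasure : IsLevyMeasure ν
  charFun_eq : ∀ (t : ℝ≥0) (ξ : EuclideanSpace ℝ (Fin d)),
    charFun (P.map (X t)) ξ = Complex.exp (-((t : ℝ) : ℂ) * levyExponent A γ ν ξ)

/-- `τ_U = inf {s > 0 : w_s ∉ U}` for a path `w`, equal to `∞` if the path never leaves `U`. -/
noncomputable def exitTime {d : ℕ} (U : Set (EuclideanSpace ℝ (Fin d)))
    (w : ℝ≥0 → EuclideanSpace ℝ (Fin d)) : ℝ≥0∞ :=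
  ⨅ (s : ℝ≥0) (_ : 0 < s ∧ w s ∉ U), (s : ℝ≥0∞)

/-- The spectral heat content `Q_U(t) = ∫_U P_x(τ_U > t) dx`. The process under `P_x` is
`x + X` under `P`. -/
noncomputable def spectralHeatContent {d : ℕ} {S : Type*} [MeasurableSpace S]
    (X : ℝ≥0 → S → EuclideanSpace ℝ (Fin d)) (P : Measure S)
    (U : Set (EuclideanSpace ℝ (Fin d))) (t : ℝ≥0) : ℝ :=
  (∫⁻ x in U, P {ω | (t : ℝ≥0∞) < exitTime U (fun s ↦ x + X s ω)}).toReal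

/-- The (finite) signed measure `σ` is the difference `μ - ν` of two possibly infinite measures:
`μ + σ⁻ = ν + σ⁺` for the Jordan decomposition `σ = σ⁺ - σ⁻`. -/
def IsSignedDifference {d : ℕ} (σ : SignedMeasure (EuclideanSpace ℝ (Fin d)))
    (μ ν : Measure (EuclideanSpace ℝ (Fin d))) : Prop :=
  μ + σ.toJordanDecomposition.negPart = ν + σ.toJordanDecomposition.posPart

/-- `∫_{‖y‖ ≤ 1} y σ(dy)` for a signed measure `σ`. -/
noncomputable def smallJumpMean {d : ℕ} (σ : SignedMeasure (EuclideanSpace ℝ (Fin d))) :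
    EuclideanSpace ℝ (Fin d) :=
  (∫ y in Metric.closedBall 0 1, y ∂σ.toJordanDecomposition.posPart)
    - ∫ y in Metric.closedBall 0 1, y ∂σ.toJordanDecomposition.negPart

/-!
The two spectral heat contents differ by at most `4 |Ω| ‖σ‖ t`, where `‖σ‖` is the total variation
of `σ`. Since `t / f t → 0`, this difference is negligible against `f`.

*Comparison of the one-dimensional laws.* Adding to `X_t` an independent compound Poisson variable
with jump measure `t σ⁻` gives the same law as adding to `Y_t` one with jump measure `t σ⁺`: the
characteristic exponents agree by `levyExponent_add_eq`, where the hypothesis on the drifts enters.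
A compound Poisson variable vanishes with probability at least `e^{-t ‖σ‖}`, so both laws,
multiplied by this factor, lie below one common probability measure
(`exists_isProbabilityMeasure_smul_map_le`).

*Comparison of the laws of the paths.* The increments over a partition of `[0, r]` are independent,
and the factors of the increments multiply to at least `e^{-r ‖σ‖}`, whatever the partition. Hence
the finite-dimensional laws on `[0, r]` differ by at most `2 r ‖σ‖` in total variation, and so do
the laws of the paths restricted to a countable set of times
(`IsLevyProcess.abs_measureReal_map_sub_le`). In this way no compound Poisson process has to be
constructed.

*Comparison of the survival probabilities.* The exit time involves uncountably many times, and a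
path may touch the complement of `Ω` at a single time outside the countable set. For a right-continuous path,
exit by time `t` is a Borel condition on the path at countably many times together with the
exit time, so the exit event is the projection of a Borel set, an analytic set. Analytic sets are
measurable for the completion of every finite measure
(`MeasureTheory.AnalyticSet.nullMeasurableSet`), so the comparison of the laws applies to the exit
event (`IsLevyProcess.measure_lt_exitTime_le_add`). Integration over `Ω` gives the bound.
-/

/-! ### Analytic sets are measurable up to null sets -/

/-- Inner regularity for continuous images of Baire space. Bounding the coordinates of the argument
one after the other, each time losing little of the outer measure of the image, leaves the image of
a compact set `∏ᵢ {0, …, bᵢ}`. -/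
theorem exists_compact_subset_range_lt_measure {α : Type*} [PseudoMetricSpace α] [T2Space α]
    [MeasurableSpace α] [BorelSpace α] (μ : Measure α) [IsFiniteMeasure μ] {f : (ℕ → ℕ) → α}
    (hf : Continuous f) {c : ℝ≥0∞} (hc : c < μ (Set.range f)) :
    ∃ K ⊆ Set.range f, IsCompact K ∧ c ≤ μ K := by
  have step : ∀ (n : ℕ) (s : {s : Set (ℕ → ℕ) // c < μ (f '' s)}),
      ∃ k : ℕ, c < μ (f '' (s.1 ∩ {x | x n ≤ k})) := by
    rintro n ⟨s, hs⟩
    have hmono : Monotone fun k : ℕ ↦ f '' (s ∩ {x | x n ≤ k}) := fun k l hkl ↦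
      Set.image_mono (Set.inter_subset_inter_right _ fun x (hx : x n ≤ k) ↦ hx.trans hkl)
    have hU : f '' s = ⋃ k : ℕ, f '' (s ∩ {x | x n ≤ k}) := by
      rw [← Set.image_iUnion, ← Set.inter_iUnion]
      congr 1
      rw [eq_comm, Set.inter_eq_left]
      exact fun x _ ↦ Set.mem_iUnion.2 ⟨x n, le_refl (x n)⟩
    rw [hU, hmono.measure_iUnion] at hs
    exact lt_iSup_iff.1 hs
  choose k hk using step
  let T : ℕ → {s : Set (ℕ → ℕ) // c < μ (f '' s)} := fun n ↦
    Nat.rec ⟨Set.univ, by rwa [Set.image_univ]⟩ (fun n s ↦ ⟨_, hk n s⟩) n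
  let b : ℕ → ℕ := fun n ↦ k n (T n)
  -- `T n` is the set of sequences whose first `n` coordinates are bounded by `b`.
  have hT : ∀ n x, x ∈ (T n).1 ↔ ∀ i < n, x i ≤ b i := by
    intro n
    induction n with
    | zero => intro x; simp [T]
    | succ n ih =>
      intro x
      have : x ∈ (T (n + 1)).1 ↔ x ∈ (T n).1 ∧ x n ≤ b n := Iff.rfl
      rw [this, ih, Nat.forall_lt_succ_right]
  let D : Set (ℕ → ℕ) := Set.univ.pi fun i ↦ Set.Iic (b i)
  have hD : IsCompact D := isCompact_univ_pi fun i ↦ (Set.finite_Iic (b i)).isCompact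
  refine ⟨f '' D, Set.image_subset_range _ _, hD.image hf, ?_⟩
  have hsub : ⋂ n, closure (f '' (T n).1) ⊆ f '' D := by
    intro y hy
    rw [Set.mem_iInter] at hy
    have : ∀ n : ℕ, ∃ x ∈ (T n).1, dist (f x) y < 1 / ((n : ℝ) + 1) := by
      intro n
      obtain ⟨_, ⟨x, hx, rfl⟩, h⟩ := Metric.mem_closure_iff.1 (hy n) _
        (Nat.one_div_pos_of_nat (n := n))
      exact ⟨x, hx, by rwa [dist_comm]⟩
    choose x hx hxy using this
    have hfx : Tendsto (fun n ↦ f (x n)) atTop (𝓝 y) := by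
      rw [tendsto_iff_dist_tendsto_zero]
      exact squeeze_zero (fun _ ↦ dist_nonneg) (fun n ↦ (hxy n).le)
        tendsto_one_div_add_atTop_nhds_zero_nat
    -- Truncating `x n` at `b` moves it into the compact set `D` without changing its first `n`
    -- coordinates.
    obtain ⟨z, hz, φ, hφ, hlim⟩ := hD.tendsto_subseq (x := fun n i ↦ min (x n i) (b i))
      fun n i _ ↦ Set.mem_Iic.2 (min_le_right _ _)
    have hlim' : Tendsto (fun n ↦ x (φ n)) atTop (𝓝 z) := by
      rw [tendsto_pi_nhds] at hlim ⊢
      intro i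
      refine (hlim i).congr' ?_
      filter_upwards [eventually_gt_atTop i] with n hn
      exact min_eq_left ((hT _ _).1 (hx (φ n)) i (hn.trans_le (hφ.id_le n)))
    exact ⟨z, hz, tendsto_nhds_unique ((hf.tendsto z).comp hlim') (hfx.comp hφ.tendsto_atTop)⟩
  refine le_trans ?_ (measure_mono hsub)
  have hanti : Antitone fun n ↦ closure (f '' (T n).1) := fun m n hmn ↦
    closure_mono (Set.image_mono fun x hx ↦
      (hT _ _).2 fun i hi ↦ (hT _ _).1 hx i (hi.trans_le hmn))
  rw [hanti.measure_iInter (fun n ↦ isClosed_closure.nullMeasurableSet) ⟨0, measure_ne_top _ _⟩]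
  exact le_iInf fun n ↦ (T n).2.le.trans (measure_mono subset_closure)

/-- Analytic sets are universally measurable. -/
theorem MeasureTheory.AnalyticSet.nullMeasurableSet {α : Type*} [TopologicalSpace α]
    [TopologicalSpace.MetrizableSpace α]
    [MeasurableSpace α] [BorelSpace α] {s : Set α} (hs : AnalyticSet s) (μ : Measure α)
    [IsFiniteMeasure μ] : NullMeasurableSet s μ := by
  let := TopologicalSpace.metrizableSpaceMetric α
  rw [AnalyticSet] at hs
  obtain rfl | ⟨f, hf, rfl⟩ := hs
  · exact MeasurableSet.empty.nullMeasurableSet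
  by_cases h0 : μ (Set.range f) = 0
  · exact NullMeasurableSet.of_null h0
  obtain ⟨c, -, hc, hlim⟩ := exists_seq_strictMono_tendsto' (pos_iff_ne_zero.2 h0)
  choose K hKs hK hcK using fun n ↦ exists_compact_subset_range_lt_measure μ hf (hc n).2
  have hmeas : MeasurableSet (⋃ n, K n) := .iUnion fun n ↦ (hK n).measurableSet
  have hle : μ (Set.range f) ≤ μ (⋃ n, K n) :=
    le_of_tendsto' hlim fun n ↦ (hcK n).trans (measure_mono (Set.subset_iUnion K n))
  exact hmeas.nullMeasurableSet.congr (ae_eq_of_subset_of_measure_ge (Set.iUnion_subset hKs) hle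
    hmeas.nullMeasurableSet (measure_ne_top _ _))

/-! ### Compound Poisson laws -/

noncomputable section compoundPoisson

variable {E : Type*} [NormedAddCommGroup E] [InnerProductSpace ℝ E] [MeasurableSpace E]
  [BorelSpace E] [SecondCountableTopology E]

/-- The `k`-fold convolution power of a measure. -/
def convPow (ρ : Measure E) : ℕ → Measure E
  | 0 => Measure.dirac 0
  | k + 1 => (convPow ρ k).conv ρ

instance isFiniteMeasure_convPow (ρ : Measure E) [IsFiniteMeasure ρ] (k : ℕ) :
    IsFiniteMeasure (convPow ρ k) := by
  induction k with
  | zero => rw [convPow]; infer_instance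
  | succ k ih => rw [convPow]; infer_instance

theorem charFun_convPow (ρ : Measure E) [IsFiniteMeasure ρ] (k : ℕ) (ξ : E) :
    charFun (convPow ρ k) ξ = charFun ρ ξ ^ k := by
  induction k with
  | zero => simp [convPow, charFun_dirac]
  | succ k ih => rw [convPow, charFun_conv, ih, pow_succ]

theorem convPow_real_univ (ρ : Measure E) [IsFiniteMeasure ρ] (k : ℕ) :
    (convPow ρ k).real Set.univ = ρ.real Set.univ ^ k := by
  have := charFun_convPow ρ k 0
  rw [charFun_zero, charFun_zero] at this
  exact_mod_cast this

/-- The weight `e^{-m} / k!` of the `k`-fold convolution power in the compound Poisson law. -/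
def compoundPoissonWeight (m : ℝ) (k : ℕ) : ℝ := Real.exp (-m) / k.factorial

/-- The compound Poisson law `e^{-ρ(E)} ∑ₖ ρ^{*k} / k!` with finite jump measure `ρ`. -/
def compoundPoisson (ρ : Measure E) : Measure E :=
  Measure.sum fun k ↦
    ENNReal.ofReal (compoundPoissonWeight (ρ.real Set.univ) k) • convPow ρ k

theorem hasSum_compoundPoissonWeight {m : ℝ} (z : ℂ) :
    HasSum (fun k ↦ (compoundPoissonWeight m k : ℂ) * z ^ k) (Complex.exp (z - m)) := by
  have h := (NormedSpace.expSeries_div_hasSum_exp (𝔸 := ℂ) z).mul_left (Complex.exp (-m))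
  rw [← Complex.exp_eq_exp_ℂ, ← Complex.exp_add, neg_add_eq_sub] at h
  have heq : (fun k ↦ (compoundPoissonWeight m k : ℂ) * z ^ k)
      = fun k ↦ Complex.exp (-m) * (z ^ k / k.factorial) := by
    funext k
    rw [compoundPoissonWeight]
    push_cast
    ring
  rwa [heq]

theorem compoundPoissonWeight_nonneg (m : ℝ) (k : ℕ) : 0 ≤ compoundPoissonWeight m k := by
  unfold compoundPoissonWeight; positivity

instance isProbabilityMeasure_compoundPoisson (ρ : Measure E) [IsFiniteMeasure ρ] :
    IsProbabilityMeasure (compoundPoisson ρ) := by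
  constructor
  have h : HasSum (fun k ↦ compoundPoissonWeight (ρ.real Set.univ) k * ρ.real Set.univ ^ k) 1 := by
    have := hasSum_compoundPoissonWeight (m := ρ.real Set.univ) (ρ.real Set.univ)
    rw [sub_self, Complex.exp_zero] at this
    rw [← Complex.hasSum_ofReal]
    push_cast
    exact this
  have h' := ENNReal.ofReal_tsum_of_nonneg (fun k ↦ mul_nonneg
    (compoundPoissonWeight_nonneg _ k) (pow_nonneg measureReal_nonneg k)) h.summable
  rw [h.tsum_eq, ENNReal.ofReal_one] at h'
  rw [compoundPoisson, Measure.sum_apply _ MeasurableSet.univ, h']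
  refine tsum_congr fun k ↦ ?_
  rw [Measure.smul_apply, smul_eq_mul, ENNReal.ofReal_mul (compoundPoissonWeight_nonneg _ k),
    ← convPow_real_univ, ofReal_measureReal]

theorem charFun_compoundPoisson (ρ : Measure E) [IsFiniteMeasure ρ] (ξ : E) :
    charFun (compoundPoisson ρ) ξ = Complex.exp (charFun ρ ξ - ρ.real Set.univ) := by
  have hint : Integrable (fun x ↦ Complex.exp (inner ℝ x ξ * Complex.I)) (compoundPoisson ρ) := by
    refine (integrable_const (1 : ℝ)).mono' (by fun_prop) (ae_of_all _ fun x ↦ ?_)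
    rw [Complex.norm_exp_ofReal_mul_I]
  have h := hasSum_integral_measure (μ := fun k ↦
    ENNReal.ofReal (compoundPoissonWeight (ρ.real Set.univ) k) • convPow ρ k) hint
  refine h.unique ?_
  have hsum := hasSum_compoundPoissonWeight (m := ρ.real Set.univ) (charFun ρ ξ)
  refine (funext fun k ↦ ?_ : (fun k ↦ _) = _) ▸ hsum
  rw [integral_smul_measure, ← charFun_apply, charFun_convPow,
    ENNReal.toReal_ofReal (compoundPoissonWeight_nonneg _ k), Complex.real_smul]

/-- A compound Poisson variable with jump measure `ρ` is zero with probability at least `e^{-ρ(E)}`,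
so adding an independent one moves at most the remaining mass. -/
theorem smul_le_conv_compoundPoisson (μ ρ : Measure E) [IsFiniteMeasure μ] [IsFiniteMeasure ρ] :
    ENNReal.ofReal (Real.exp (-ρ.real Set.univ)) • μ ≤ μ.conv (compoundPoisson ρ) := by
  have hdirac : ENNReal.ofReal (Real.exp (-ρ.real Set.univ)) • Measure.dirac 0
      ≤ compoundPoisson ρ := by
    have := Measure.le_sum (fun k ↦
      ENNReal.ofReal (compoundPoissonWeight (ρ.real Set.univ) k) • convPow ρ k) 0
    simpa [compoundPoisson, compoundPoissonWeight, convPow] using this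
  have h : μ.conv (ENNReal.ofReal (Real.exp (-ρ.real Set.univ)) • Measure.dirac 0)
      ≤ μ.conv (compoundPoisson ρ) :=
    Measure.map_mono (Measure.prod_mono le_rfl hdirac) (by fun_prop)
  rwa [Measure.conv_comm, Measure.conv_smul_left, Measure.dirac_zero_conv] at h

end compoundPoisson

/-! ### Comparison of the one-dimensional laws -/

/-- The integrand `e^{i⟨ξ, y⟩} - 1 - i ⟨ξ, y⟩ 1_{‖y‖ ≤ 1}` of the Lévy–Khintchine formula. -/
noncomputable def levyKernel {d : ℕ} (ξ y : EuclideanSpace ℝ (Fin d)) : ℂ :=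
  Complex.exp (Complex.I * (inner ℝ ξ y : ℝ)) - 1
    - Complex.I * (if ‖y‖ ≤ 1 then (inner ℝ ξ y : ℝ) else 0 : ℝ)

theorem norm_exp_I_mul_sub_one_sub_le (x : ℝ) :
    ‖Complex.exp (Complex.I * x) - 1 - Complex.I * x‖ ≤ 3 * x ^ 2 := by
  have hx : ‖Complex.I * (x : ℂ)‖ = |x| := by simp
  rcases le_total |x| 1 with h | h
  · refine (Complex.norm_exp_sub_one_sub_id_le (hx.trans_le h)).trans ?_
    rw [hx, sq_abs]
    nlinarith [sq_nonneg x]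
  · have h1 : ‖Complex.exp (Complex.I * x)‖ = 1 := by
      rw [mul_comm, Complex.norm_exp_ofReal_mul_I]
    refine (norm_sub_le _ _).trans ((add_le_add_left (norm_sub_le _ _) _).trans ?_)
    rw [h1, hx, norm_one, ← sq_abs]
    nlinarith

theorem norm_levyKernel_le {d : ℕ} (ξ y : EuclideanSpace ℝ (Fin d)) :
    ‖levyKernel ξ y‖ ≤ (3 * ‖ξ‖ ^ 2 + 2) * min 1 (‖y‖ ^ 2) := by
  unfold levyKernel
  split_ifs with h
  · have hy : ‖y‖ ^ 2 ≤ 1 := pow_le_one₀ (norm_nonneg y) h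
    rw [min_eq_right hy]
    refine (norm_exp_I_mul_sub_one_sub_le _).trans ?_
    have : (inner ℝ ξ y) ^ 2 ≤ (‖ξ‖ * ‖y‖) ^ 2 := by
      rw [← sq_abs]
      exact pow_le_pow_left₀ (abs_nonneg _) (abs_real_inner_le_norm ξ y) 2
    nlinarith [sq_nonneg ‖y‖]
  · have hy : 1 ≤ ‖y‖ ^ 2 := one_le_pow₀ (not_le.1 h).le
    have h1 : ‖Complex.exp (Complex.I * (inner ℝ ξ y : ℝ))‖ = 1 := by
      rw [mul_comm, Complex.norm_exp_ofReal_mul_I]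
    rw [min_eq_left hy, Complex.ofReal_zero, mul_zero, sub_zero]
    refine (norm_sub_le _ _).trans ?_
    rw [h1, norm_one]
    nlinarith [sq_nonneg ‖ξ‖]

theorem measurable_levyKernel {d : ℕ} (ξ : EuclideanSpace ℝ (Fin d)) :
    Measurable (levyKernel ξ) := by
  unfold levyKernel
  have : Measurable fun y : EuclideanSpace ℝ (Fin d) ↦
      (if ‖y‖ ≤ 1 then (inner ℝ ξ y : ℝ) else 0 : ℝ) :=
    Measurable.ite (measurableSet_le measurable_norm measurable_const) (by fun_prop) (by fun_prop)
  fun_prop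

theorem integrable_levyKernel {d : ℕ} {ν : Measure (EuclideanSpace ℝ (Fin d))}
    (hν : ∫⁻ y, ENNReal.ofReal (min 1 (‖y‖ ^ 2)) ∂ν < ∞) (ξ : EuclideanSpace ℝ (Fin d)) :
    Integrable (levyKernel ξ) ν := by
  have hmin : Integrable (fun y : EuclideanSpace ℝ (Fin d) ↦ min 1 (‖y‖ ^ 2)) ν := by
    refine ⟨by fun_prop, ?_⟩
    rwa [hasFiniteIntegral_iff_ofReal (ae_of_all _ fun y ↦ by positivity)]
  exact (hmin.const_mul (3 * ‖ξ‖ ^ 2 + 2)).mono' (measurable_levyKernel ξ).aestronglyMeasurable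
    (ae_of_all _ fun y ↦ norm_levyKernel_le ξ y)

theorem integrable_levyKernel_of_isFiniteMeasure {d : ℕ} (ρ : Measure (EuclideanSpace ℝ (Fin d)))
    [IsFiniteMeasure ρ] (ξ : EuclideanSpace ℝ (Fin d)) : Integrable (levyKernel ξ) ρ := by
  refine integrable_levyKernel (lt_of_le_of_lt (lintegral_mono (g := fun _ ↦ 1) fun y ↦ ?_) ?_) ξ
  · exact ENNReal.ofReal_le_one.2 (min_le_left _ _)
  · simp

theorem integral_levyKernel_of_isFiniteMeasure {d : ℕ} (ρ : Measure (EuclideanSpace ℝ (Fin d)))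
    [IsFiniteMeasure ρ] (ξ : EuclideanSpace ℝ (Fin d)) :
    ∫ y, levyKernel ξ y ∂ρ = charFun ρ ξ - ρ.real Set.univ
      - Complex.I * (inner ℝ ξ (∫ y in Metric.closedBall 0 1, y ∂ρ) : ℝ) := by
  have hexp : Integrable (fun y ↦ Complex.exp (Complex.I * (inner ℝ ξ y : ℝ))) ρ := by
    refine (integrable_const (1 : ℝ)).mono' (by fun_prop) (ae_of_all _ fun x ↦ ?_)
    rw [mul_comm, Complex.norm_exp_ofReal_mul_I]
  have hid : IntegrableOn (fun y : EuclideanSpace ℝ (Fin d) ↦ y) (Metric.closedBall 0 1) ρ :=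
    Measure.integrableOn_of_bounded (M := 1) (measure_ne_top _ _) (by fun_prop)
      ((ae_restrict_iff' Metric.isClosed_closedBall.measurableSet).2
        (ae_of_all _ fun y hy ↦ mem_closedBall_zero_iff.1 hy))
  have hind : (fun y : EuclideanSpace ℝ (Fin d) ↦ if ‖y‖ ≤ 1 then (inner ℝ ξ y : ℝ) else 0)
      = (Metric.closedBall 0 1).indicator fun y ↦ inner ℝ ξ y := by
    funext y
    by_cases h : ‖y‖ ≤ 1 <;> simp [Set.indicator, h]
  have hlin : Integrable
      (fun y : EuclideanSpace ℝ (Fin d) ↦ if ‖y‖ ≤ 1 then (inner ℝ ξ y : ℝ) else 0) ρ := by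
    rw [hind, integrable_indicator_iff Metric.isClosed_closedBall.measurableSet]
    exact Integrable.const_inner ξ hid
  have hexp_one : Integrable (fun y ↦ Complex.exp (Complex.I * (inner ℝ ξ y : ℝ)) - 1) ρ :=
    hexp.sub (integrable_const 1)
  have hlin_I : Integrable (fun y : EuclideanSpace ℝ (Fin d) ↦
      Complex.I * ((if ‖y‖ ≤ 1 then (inner ℝ ξ y : ℝ) else 0 : ℝ) : ℂ)) ρ :=
    hlin.ofReal.const_mul _
  unfold levyKernel
  rw [integral_sub hexp_one hlin_I,
    integral_sub hexp (integrable_const 1), integral_const_mul, integral_complex_ofReal, hind,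
    integral_indicator Metric.isClosed_closedBall.measurableSet, integral_inner hid]
  congr 2
  · rw [charFun_apply]
    simp_rw [real_inner_comm, mul_comm]
  · simp

/-- The identity `ψ^X(ξ) - ψ^Y(ξ) = ∫ (1 - e^{i⟨ξ, y⟩}) σ(dy)`, with the terms moved so that only
positive measures occur. -/
theorem levyExponent_add_eq {d : ℕ} (A : Matrix (Fin d) (Fin d) ℝ)
    {γX γY : EuclideanSpace ℝ (Fin d)} {νX νY : Measure (EuclideanSpace ℝ (Fin d))}
    (hX : IsLevyMeasure νX) (hY : IsLevyMeasure νY)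
    {σ : SignedMeasure (EuclideanSpace ℝ (Fin d))} (hσ : IsSignedDifference σ νX νY)
    (hγ : γX - γY = smallJumpMean σ) (ξ : EuclideanSpace ℝ (Fin d)) :
    levyExponent A γX νX ξ + (σ.toJordanDecomposition.negPart.real Set.univ
        - charFun σ.toJordanDecomposition.negPart ξ)
      = levyExponent A γY νY ξ + (σ.toJordanDecomposition.posPart.real Set.univ
        - charFun σ.toJordanDecomposition.posPart ξ) := by
  set n := σ.toJordanDecomposition.negPart with hn
  set p := σ.toJordanDecomposition.posPart with hp
  have h := congrArg (fun μ ↦ ∫ y, levyKernel ξ y ∂μ) hσ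
  simp only [← hn, ← hp] at h
  rw [integral_add_measure (integrable_levyKernel hX.2 ξ)
      (integrable_levyKernel_of_isFiniteMeasure n ξ),
    integral_add_measure (integrable_levyKernel hY.2 ξ)
      (integrable_levyKernel_of_isFiniteMeasure p ξ),
    integral_levyKernel_of_isFiniteMeasure n ξ, integral_levyKernel_of_isFiniteMeasure p ξ] at h
  have hγ' : (inner ℝ ξ γX : ℝ) - inner ℝ ξ γY
      = inner ℝ ξ (∫ y in Metric.closedBall 0 1, y ∂p)
        - inner ℝ ξ (∫ y in Metric.closedBall 0 1, y ∂n) := by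
    rw [← inner_sub_right, ← inner_sub_right, hγ, smallJumpMean]
  have hγ'' := congrArg (fun r : ℝ ↦ (r : ℂ)) hγ'
  push_cast at hγ''
  change _ - ∫ y, levyKernel ξ y ∂νX + _ = _ - ∫ y, levyKernel ξ y ∂νY + _
  linear_combination -h - Complex.I * hγ''

/-- At each time `t` both laws are, up to the factor `e^{-tλ}`, dominated by a common probability
measure: the law of `X_t` plus an independent compound Poisson variable with jump measure `t σ⁻`,
which is also the law of `Y_t` plus one with jump measure `t σ⁺`. -/
theorem exists_isProbabilityMeasure_smul_map_le {d : ℕ}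
    {S : Type*} [MeasurableSpace S] {P : Measure S} [IsProbabilityMeasure P]
    {S' : Type*} [MeasurableSpace S'] {P' : Measure S'} [IsProbabilityMeasure P']
    {X : ℝ≥0 → S → EuclideanSpace ℝ (Fin d)} {Y : ℝ≥0 → S' → EuclideanSpace ℝ (Fin d)}
    {A : Matrix (Fin d) (Fin d) ℝ} {γX γY : EuclideanSpace ℝ (Fin d)}
    {νX νY : Measure (EuclideanSpace ℝ (Fin d))}
    (hX : IsLevyProcessWithTriplet X P A γX νX) (hY : IsLevyProcessWithTriplet Y P' A γY νY)
    {σ : SignedMeasure (EuclideanSpace ℝ (Fin d))} (hσ : IsSignedDifference σ νX νY)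
    (hγ : γX - γY = smallJumpMean σ) (t : ℝ≥0) :
    ∃ ζ : Measure (EuclideanSpace ℝ (Fin d)), IsProbabilityMeasure ζ ∧
      ENNReal.ofReal (Real.exp (-(t * σ.totalVariation.real Set.univ))) • P.map (X t) ≤ ζ ∧
      ENNReal.ofReal (Real.exp (-(t * σ.totalVariation.real Set.univ))) • P'.map (Y t) ≤ ζ := by
  have hXm := hX.isLevyProcess.measurable t
  have hYm := hY.isLevyProcess.measurable t
  have := Measure.isProbabilityMeasure_map (μ := P) hXm.aemeasurable
  have := Measure.isProbabilityMeasure_map (μ := P') hYm.aemeasurable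
  set n := σ.toJordanDecomposition.negPart with hn
  set p := σ.toJordanDecomposition.posPart with hp
  have hreal : ∀ ρ : Measure (EuclideanSpace ℝ (Fin d)),
      (t • ρ).real Set.univ = t * ρ.real Set.univ := fun ρ ↦ by
    rw [measureReal_nnreal_smul_apply]
  have hchar : ∀ (ρ : Measure (EuclideanSpace ℝ (Fin d))) (ξ : EuclideanSpace ℝ (Fin d)),
      charFun (t • ρ) ξ = t * charFun ρ ξ := fun ρ ξ ↦ by
    rw [charFun_apply, integral_smul_nnreal_measure, ← charFun_apply]
    rfl
  have htv : σ.totalVariation.real Set.univ = p.real Set.univ + n.real Set.univ := by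
    rw [SignedMeasure.totalVariation, measureReal_add_apply]
  have heq : (P.map (X t)).conv (compoundPoisson (t • n))
      = (P'.map (Y t)).conv (compoundPoisson (t • p)) := by
    refine Measure.ext_of_charFun (funext fun ξ ↦ ?_)
    rw [charFun_conv, charFun_conv, charFun_compoundPoisson, charFun_compoundPoisson,
      hX.charFun_eq, hY.charFun_eq, ← Complex.exp_add, ← Complex.exp_add, hreal, hreal, hchar,
      hchar]
    congr 1
    push_cast
    linear_combination (-(t : ℂ)) * levyExponent_add_eq A hX.isLevyMeasure hY.isLevyMeasure hσ hγ ξ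
  have hle : ∀ (μ ρ : Measure (EuclideanSpace ℝ (Fin d))) [IsFiniteMeasure μ] [IsFiniteMeasure ρ],
      ρ.real Set.univ ≤ σ.totalVariation.real Set.univ →
      ENNReal.ofReal (Real.exp (-(t * σ.totalVariation.real Set.univ))) • μ
        ≤ μ.conv (compoundPoisson (t • ρ)) := by
    intro μ ρ _ _ hρ
    refine le_trans ?_ (smul_le_conv_compoundPoisson μ (t • ρ))
    rw [hreal]
    gcongr
  refine ⟨(P.map (X t)).conv (compoundPoisson (t • n)), inferInstance, hle _ n ?_, heq ▸ hle _ p ?_⟩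
  · rw [htv]
    exact le_add_of_nonneg_left measureReal_nonneg
  · rw [htv]
    exact le_add_of_nonneg_right measureReal_nonneg

/-! ### Comparison of the laws of the paths -/

theorem MeasureTheory.Measure.pi_mono {ι : Type*} [Fintype ι] {α : ι → Type*}
    [∀ i, MeasurableSpace (α i)] {μ ν : ∀ i, Measure (α i)} [∀ i, SigmaFinite (μ i)]
    [∀ i, SigmaFinite (ν i)] (h : ∀ i, μ i ≤ ν i) : Measure.pi μ ≤ Measure.pi ν := by
  refine Measure.le_iff.2 fun s hs ↦ ?_
  rw [Measure.pi, Measure.pi, toMeasure_apply _ _ hs, toMeasure_apply _ _ hs]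
  refine OuterMeasure.le_boundedBy.2 (fun t ↦ (OuterMeasure.boundedBy_le t).trans ?_) s
  exact Finset.prod_le_prod' fun i _ ↦ h i _

theorem prod_smul_pi_le {ι : Type*} [Fintype ι] {α : ι → Type*}
    [∀ i, MeasurableSpace (α i)] {μ ζ : ∀ i, Measure (α i)} [∀ i, IsProbabilityMeasure (μ i)]
    [∀ i, IsProbabilityMeasure (ζ i)] {a : ι → ℝ}
    (h : ∀ i, ENNReal.ofReal (a i) • μ i ≤ ζ i) :
    (∏ i, ENNReal.ofReal (a i)) • Measure.pi μ ≤ Measure.pi ζ := by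
  have : ∀ i, IsFiniteMeasure (ENNReal.ofReal (a i) • μ i) := fun i ↦
    (μ i).smul_finite ENNReal.ofReal_ne_top
  have heq : Measure.pi (fun i ↦ ENNReal.ofReal (a i) • μ i)
      = (∏ i, ENNReal.ofReal (a i)) • Measure.pi μ := by
    refine Measure.pi_eq fun s _ ↦ ?_
    simp only [Measure.smul_apply, Measure.pi_pi, smul_eq_mul, Finset.prod_mul_distrib]
  rw [← heq]
  exact Measure.pi_mono h

/-- The law of a Lévy process at finitely many times `0 = t₀ ≤ ⋯ ≤ tₙ` is the law of the partial
sums of independent variables distributed as the increments. -/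
theorem IsLevyProcess.map_eq_map_pi {d : ℕ} {S : Type*} [MeasurableSpace S] {P : Measure S}
    [IsProbabilityMeasure P] {X : ℝ≥0 → S → EuclideanSpace ℝ (Fin d)} (hX : IsLevyProcess X P)
    {n : ℕ} {t : Fin (n + 1) → ℝ≥0} (ht : Monotone t) (h0 : t 0 = 0) :
    P.map (fun ω k ↦ X (t k) ω)
      = (Measure.pi fun j : Fin n ↦ P.map (X (t j.succ - t j.castSucc))).map
        fun w (k : Fin (n + 1)) ↦ ∑ j with j.castSucc < k, w j := by
  have hm := hX.measurable
  have hle : ∀ j : Fin n, t j.castSucc ≤ t j.succ := fun j ↦ ht (Fin.castSucc_lt_succ).le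
  have hincr : ∀ j : Fin n, P.map (X (t j.succ - t j.castSucc))
      = P.map fun ω ↦ X (t j.succ) ω - X (t j.castSucc) ω := fun j ↦ by
    rw [← (hX.stationary_increments (t j.castSucc) (t j.succ - t j.castSucc)).map_eq,
      add_tsub_cancel_of_le (hle j)]
  simp_rw [hincr]
  rw [← (iIndepFun_iff_map_fun_eq_pi_map fun j ↦ by fun_prop).1 (hX.indep_increments n t ht),
    Measure.map_map (by fun_prop) (by fun_prop)]
  refine Measure.map_congr ?_
  filter_upwards [hX.start_zero] with ω hω
  funext k
  simp only [Function.comp_apply]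
  induction k using Fin.induction with
  | zero => simp [h0, hω]
  | succ k ih =>
    have : (Finset.univ.filter fun j : Fin n ↦ j.castSucc < k.succ)
        = insert k (Finset.univ.filter fun j : Fin n ↦ j.castSucc < k.castSucc) := by
      ext j
      simp only [Finset.mem_filter, Finset.mem_univ, true_and, Finset.mem_insert,
        Fin.castSucc_lt_succ_iff, Fin.castSucc_lt_castSucc_iff, le_iff_eq_or_lt]
    rw [this, Finset.sum_insert (by simp), ← ih, sub_add_cancel]

/-- Finitely many times, listed in increasing order and with `0` added. -/
theorem exists_monotone_reindex {ι : Type*} [Finite ι] (u : ι → ℝ≥0) {r : ℝ≥0} (hu : ∀ i, u i ≤ r) :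
    ∃ (n : ℕ) (t : Fin (n + 1) → ℝ≥0) (k : ι → Fin (n + 1)), Monotone t ∧ t 0 = 0 ∧
      (∀ j, t j ≤ r) ∧ ∀ i, t (k i) = u i := by
  classical
  have := Fintype.ofFinite ι
  let T : Finset ℝ≥0 := insert 0 (Finset.univ.image u)
  have h0 : (0 : ℝ≥0) ∈ T := Finset.mem_insert_self _ _
  obtain ⟨n, hn⟩ := Nat.exists_eq_add_one.2 (Finset.card_pos.2 ⟨0, h0⟩)
  have hrange := Finset.range_orderEmbOfFin T hn
  have hex : ∀ τ ∈ T, ∃ j, T.orderEmbOfFin hn j = τ := fun τ hτ ↦ by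
    rwa [← Finset.mem_coe, ← hrange] at hτ
  choose k hk using fun i ↦ hex (u i)
    (Finset.mem_insert_of_mem (Finset.mem_image_of_mem u (Finset.mem_univ i)))
  refine ⟨n, T.orderEmbOfFin hn, k, (T.orderEmbOfFin hn).monotone, ?_, fun j ↦ ?_, hk⟩
  · obtain ⟨j, hj⟩ := hex 0 h0
    exact le_antisymm (hj ▸ (T.orderEmbOfFin hn).monotone (Fin.zero_le j)) zero_le
  · have := Finset.orderEmbOfFin_mem T hn j
    simp only [T, Finset.mem_insert, Finset.mem_image, Finset.mem_univ, true_and] at this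
    obtain h | ⟨i, hi⟩ := this
    · exact h ▸ zero_le
    · exact hi ▸ hu i

theorem sum_sub_castSucc_le {n : ℕ} {t : Fin (n + 1) → ℝ≥0} (ht : Monotone t) {r : ℝ≥0}
    (hr : ∀ j, t j ≤ r) : ∑ j : Fin n, (t j.succ - t j.castSucc) ≤ r := by
  have hle : ∀ j : Fin n, t j.castSucc ≤ t j.succ := fun j ↦ ht (Fin.castSucc_lt_succ).le
  rw [← NNReal.coe_le_coe]
  push_cast
  calc ∑ j : Fin n, ((t j.succ - t j.castSucc : ℝ≥0) : ℝ)
      = ∑ j : Fin n, ((t j.succ : ℝ) - t j.castSucc) :=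
        Finset.sum_congr rfl fun j _ ↦ NNReal.coe_sub (hle j)
    _ = t (Fin.last n) - t 0 := by
        have h1 := Fin.sum_univ_succ fun j ↦ (t j : ℝ)
        have h2 := Fin.sum_univ_castSucc fun j ↦ (t j : ℝ)
        rw [Finset.sum_sub_distrib]
        linarith
    _ ≤ r := (sub_le_self _ (NNReal.coe_nonneg _)).trans (NNReal.coe_le_coe.2 (hr _))

/-- Two probability measures with most of their mass below a common one are close in total
variation. -/
theorem measureReal_le_add_of_smul_le {α : Type*} [MeasurableSpace α] {μ μ' ζ : Measure α}
    [IsProbabilityMeasure μ] [IsProbabilityMeasure μ'] [IsProbabilityMeasure ζ] {a : ℝ}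
    (ha : 0 ≤ a) (h : ENNReal.ofReal (Real.exp (-a)) • μ ≤ ζ)
    (h' : ENNReal.ofReal (Real.exp (-a)) • μ' ≤ ζ) {B : Set α} (hB : MeasurableSet B) :
    μ.real B ≤ μ'.real B + 2 * a := by
  have key : ∀ (ρ : Measure α) (C : Set α), ENNReal.ofReal (Real.exp (-a)) • ρ ≤ ζ →
      Real.exp (-a) * ρ.real C ≤ ζ.real C := fun ρ C hρ ↦ by
    have := ENNReal.toReal_mono (measure_ne_top ζ C) (hρ C)
    rwa [Measure.smul_apply, smul_eq_mul, ENNReal.toReal_mul,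
      ENNReal.toReal_ofReal (Real.exp_pos _).le] at this
  have h1 := key μ B h
  have h2 := key μ' Bᶜ h'
  rw [probReal_compl_eq_one_sub hB, probReal_compl_eq_one_sub hB] at h2
  -- `μ B ≤ (1 - e^{-a}) + e^{-a} μ B ≤ (1 - e^{-a}) + ζ B ≤ 2 (1 - e^{-a}) + μ' B`
  have h3 : 1 - a ≤ Real.exp (-a) := by linarith [Real.add_one_le_exp (-a)]
  have h4 : Real.exp (-a) ≤ 1 := Real.exp_le_one_iff.2 (by linarith)
  have h5 : μ.real B ≤ 1 := measureReal_le_one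
  have h6 : 0 ≤ μ'.real B := measureReal_nonneg
  nlinarith

/-- If the one-dimensional laws of a Lévy process at the times `tⱼ₊₁ - tⱼ` are, up to factors
`e^{-c (tⱼ₊₁ - tⱼ)}`, dominated by `ζⱼ`, then the finite-dimensional laws up to time `r` are
dominated up to a factor `e^{-rc}`, because the exponents add up. -/
theorem IsLevyProcess.smul_map_le_map_pi {d : ℕ} {S : Type*} [MeasurableSpace S] {P : Measure S}
    [IsProbabilityMeasure P] {X : ℝ≥0 → S → EuclideanSpace ℝ (Fin d)} (hX : IsLevyProcess X P)
    {n : ℕ} {t : Fin (n + 1) → ℝ≥0} (ht : Monotone t) (h0 : t 0 = 0) {r : ℝ≥0}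
    (hr : ∀ j, t j ≤ r) {c : ℝ} (hc : 0 ≤ c) {ζ : Fin n → Measure (EuclideanSpace ℝ (Fin d))}
    [∀ j, IsProbabilityMeasure (ζ j)]
    (hζ : ∀ j : Fin n, ENNReal.ofReal (Real.exp (-((t j.succ - t j.castSucc : ℝ≥0) * c)))
      • P.map (X (t j.succ - t j.castSucc)) ≤ ζ j)
    {ι : Type*} (k : ι → Fin (n + 1)) :
    ENNReal.ofReal (Real.exp (-(r * c))) • P.map (fun ω i ↦ X (t (k i)) ω)
      ≤ (Measure.pi ζ).map fun w i ↦ ∑ j with j.castSucc < k i, w j := by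
  have hm := hX.measurable
  have hprob : ∀ j : Fin n, IsProbabilityMeasure (P.map (X (t j.succ - t j.castSucc))) :=
    fun j ↦ Measure.isProbabilityMeasure_map (hm _).aemeasurable
  have hmap : P.map (fun ω i ↦ X (t (k i)) ω)
      = (Measure.pi fun j : Fin n ↦ P.map (X (t j.succ - t j.castSucc))).map
        fun w i ↦ ∑ j with j.castSucc < k i, w j := by
    have := congrArg (Measure.map fun (v : Fin (n + 1) → EuclideanSpace ℝ (Fin d)) i ↦ v (k i))
      (hX.map_eq_map_pi ht h0)
    rwa [Measure.map_map (by fun_prop) (by fun_prop),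
      Measure.map_map (by fun_prop) (by fun_prop)] at this
  rw [hmap, ← Measure.map_smul]
  refine Measure.map_mono (le_trans ?_ (prod_smul_pi_le hζ)) (by fun_prop)
  have hexp : ENNReal.ofReal (Real.exp (-(r * c)))
      ≤ ∏ j : Fin n, ENNReal.ofReal (Real.exp (-((t j.succ - t j.castSucc : ℝ≥0) * c))) := by
    rw [← ENNReal.ofReal_prod_of_nonneg fun _ _ ↦ (Real.exp_pos _).le, ← Real.exp_sum,
      Finset.sum_neg_distrib, ← Finset.sum_mul, ← NNReal.coe_sum]
    gcongr
    exact sum_sub_castSucc_le ht hr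
  refine Measure.le_iff.2 fun s _ ↦ ?_
  rw [Measure.smul_apply, Measure.smul_apply]
  gcongr

section TwoProcesses

variable {d : ℕ} {S S' : Type*} [MeasurableSpace S] [MeasurableSpace S'] {P : Measure S}
  {P' : Measure S'} [IsProbabilityMeasure P] [IsProbabilityMeasure P']
  {X : ℝ≥0 → S → EuclideanSpace ℝ (Fin d)} {Y : ℝ≥0 → S' → EuclideanSpace ℝ (Fin d)} {c : ℝ}

theorem IsLevyProcess.exists_isProbabilityMeasure_smul_map_le (hX : IsLevyProcess X P)
    (hY : IsLevyProcess Y P') (hc : 0 ≤ c)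
    (h : ∀ t : ℝ≥0, ∃ ζ : Measure (EuclideanSpace ℝ (Fin d)), IsProbabilityMeasure ζ ∧
      ENNReal.ofReal (Real.exp (-(t * c))) • P.map (X t) ≤ ζ ∧
      ENNReal.ofReal (Real.exp (-(t * c))) • P'.map (Y t) ≤ ζ)
    {ι : Type*} [Finite ι] (u : ι → ℝ≥0) {r : ℝ≥0} (hu : ∀ i, u i ≤ r) :
    ∃ ζ : Measure (ι → EuclideanSpace ℝ (Fin d)), IsProbabilityMeasure ζ ∧
      ENNReal.ofReal (Real.exp (-(r * c))) • P.map (fun ω i ↦ X (u i) ω) ≤ ζ ∧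
      ENNReal.ofReal (Real.exp (-(r * c))) • P'.map (fun ω i ↦ Y (u i) ω) ≤ ζ := by
  obtain ⟨n, t, k, ht, h0, hr, hk⟩ := exists_monotone_reindex u hu
  choose ζ hζ hζX hζY using fun j : Fin n ↦ h (t j.succ - t j.castSucc)
  simp_rw [← hk]
  exact ⟨_, Measure.isProbabilityMeasure_map (by fun_prop), hX.smul_map_le_map_pi ht h0 hr hc hζX k,
    hY.smul_map_le_map_pi ht h0 hr hc hζY k⟩

/-- The laws of two Lévy processes at countably many times before `r` are close in total variation.
The bound for finitely many times does not depend on the times, so it holds for all measurable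
cylinders, and these approximate every measurable set. -/
theorem IsLevyProcess.abs_measureReal_map_sub_le (hX : IsLevyProcess X P)
    (hY : IsLevyProcess Y P') (hc : 0 ≤ c)
    (h : ∀ t : ℝ≥0, ∃ ζ : Measure (EuclideanSpace ℝ (Fin d)), IsProbabilityMeasure ζ ∧
      ENNReal.ofReal (Real.exp (-(t * c))) • P.map (X t) ≤ ζ ∧
      ENNReal.ofReal (Real.exp (-(t * c))) • P'.map (Y t) ≤ ζ)
    (u : ℕ → ℝ≥0) {r : ℝ≥0} (hu : ∀ i, u i ≤ r) {B : Set (ℕ → EuclideanSpace ℝ (Fin d))}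
    (hB : MeasurableSet B) :
    |(P.map fun ω i ↦ X (u i) ω).real B - (P'.map fun ω i ↦ Y (u i) ω).real B|
      ≤ 2 * (r * c) := by
  have hXm := hX.measurable
  have hYm := hY.measurable
  set μ := P.map fun ω i ↦ X (u i) ω with hμ
  set μ' := P'.map fun ω i ↦ Y (u i) ω with hμ'
  have : IsProbabilityMeasure μ := Measure.isProbabilityMeasure_map (by fun_prop)
  have : IsProbabilityMeasure μ' := Measure.isProbabilityMeasure_map (by fun_prop)
  have hcyl : ∀ C ∈ measurableCylinders fun _ : ℕ ↦ EuclideanSpace ℝ (Fin d),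
      |μ.real C - μ'.real C| ≤ 2 * (r * c) := by
    intro C hC
    obtain ⟨I, D, hD, rfl⟩ := (mem_measurableCylinders C).1 hC
    obtain ⟨ζ, hζ, hζX, hζY⟩ := hX.exists_isProbabilityMeasure_smul_map_le hY hc h
      (fun i : I ↦ u i) (fun i ↦ hu i)
    have : IsProbabilityMeasure (P.map fun ω (i : I) ↦ X (u i) ω) :=
      Measure.isProbabilityMeasure_map (by fun_prop)
    have : IsProbabilityMeasure (P'.map fun ω (i : I) ↦ Y (u i) ω) :=
      Measure.isProbabilityMeasure_map (by fun_prop)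
    have hrc : 0 ≤ r * c := by positivity
    have h1 := measureReal_le_add_of_smul_le hrc hζX hζY hD
    have h2 := measureReal_le_add_of_smul_le hrc hζY hζX hD
    have e1 : μ.real (cylinder I D) = (P.map fun ω (i : I) ↦ X (u i) ω).real D := by
      rw [map_measureReal_apply (by fun_prop) hD.cylinder, map_measureReal_apply (by fun_prop) hD]
      rfl
    have e2 : μ'.real (cylinder I D) = (P'.map fun ω (i : I) ↦ Y (u i) ω).real D := by
      rw [map_measureReal_apply (by fun_prop) hD.cylinder, map_measureReal_apply (by fun_prop) hD]
      rfl
    rw [e1, e2, abs_sub_le_iff]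
    constructor <;> linarith
  refine le_of_forall_pos_le_add fun ε hε ↦ ?_
  have hdense := Measure.MeasureDense.of_generateFrom_isSetAlgebra_finite (μ := μ + μ')
    (isSetAlgebra_measurableCylinders (α := fun _ : ℕ ↦ EuclideanSpace ℝ (Fin d)))
    generateFrom_measurableCylinders.symm
  obtain ⟨C, hC, hBC⟩ := hdense.approx B hB (measure_ne_top _ _) ε hε
  have hCm : MeasurableSet C := .of_mem_measurableCylinders hC
  have hsd : μ.real (symmDiff B C) + μ'.real (symmDiff B C) ≤ ε := by
    rw [← measureReal_add_apply]
    exact ENNReal.toReal_le_of_le_ofReal hε.le hBC.le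
  have h1 := abs_measureReal_sub_le_measureReal_symmDiff (μ := μ) hB.nullMeasurableSet
    hCm.nullMeasurableSet
  have h2 := abs_measureReal_sub_le_measureReal_symmDiff (μ := μ') hB.nullMeasurableSet
    hCm.nullMeasurableSet
  have h3 := hcyl C hC
  rw [abs_le] at *
  constructor <;> linarith [h1.1, h1.2, h2.1, h2.2, h3.1, h3.2]

end TwoProcesses

/-! ### The exit event and the spectral heat content -/

/-- The paths, sampled at the times `u 0, u 1, …`, that approach `F` from the right of some time
`s ≤ t`, in the sense that the distance to `F` tends to `0` along the sampling times decreasing to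
`s`. The limit is written out with countable quantifiers, so that this is a Borel condition on the
pair (path, `s`). -/
def hittingPaths {E : Type*} [PseudoEMetricSpace E] (F : Set E) (u : ℕ → ℝ≥0) (t : ℝ≥0) :
    Set (ℕ → E) :=
  {w | ∃ s ≤ t, ∀ n : ℕ, ∃ m : ℕ, ∀ k, s < u k → u k < s + 1 / (m + 1) →
    Metric.infEDist (w k) F ≤ (n + 1 : ℝ≥0∞)⁻¹}

theorem analyticSet_hittingPaths {E : Type*} [PseudoEMetricSpace E] [PolishSpace E]
    [MeasurableSpace E] [BorelSpace E] (F : Set E) (u : ℕ → ℝ≥0) (t : ℝ≥0) :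
    AnalyticSet (hittingPaths F u t) := by
  have hmeas : MeasurableSet {p : (ℕ → E) × ℝ≥0 | p.2 ≤ t ∧ ∀ n : ℕ, ∃ m : ℕ, ∀ k,
      p.2 < u k → u k < p.2 + 1 / (m + 1) →
        Metric.infEDist (p.1 k) F ≤ (n + 1 : ℝ≥0∞)⁻¹} := by
    refine (measurableSet_le (by fun_prop) (by fun_prop)).inter (measurableSet_setOfPred.2 ?_)
    refine .forall fun n ↦ .exists fun m ↦ .forall fun k ↦ ?_
    refine (measurableSet_setOfPred.1 (measurableSet_lt (by fun_prop) (by fun_prop))).imp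
      ((measurableSet_setOfPred.1 (measurableSet_lt (by fun_prop) (by fun_prop))).imp
        (measurableSet_setOfPred.1 (measurableSet_le ?_ (by fun_prop))))
    exact measurable_infEDist.comp ((measurable_pi_apply k).comp measurable_fst)
  convert hmeas.analyticSet.image_of_continuous continuous_fst using 1
  ext w
  simp [hittingPaths]

theorem mem_hittingPaths_iff {E : Type*} [PseudoEMetricSpace E] {F : Set E} (hF : IsClosed F)
    {u : ℕ → ℝ≥0} {t : ℝ≥0} (hu : ∀ s ≤ t, ∀ δ > 0, ∃ k, s < u k ∧ u k < s + δ) {v : ℝ≥0 → E}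
    (hv : ∀ s, ContinuousWithinAt v (Set.Ici s) s) :
    (fun k ↦ v (u k)) ∈ hittingPaths F u t ↔ ∃ s ≤ t, v s ∈ F := by
  have hcont : ∀ s, ContinuousWithinAt (fun q ↦ Metric.infEDist (v q) F) (Set.Ici s) s :=
    fun s ↦ Metric.continuous_infEDist.continuousAt.comp_continuousWithinAt (hv s)
  -- A right neighbourhood of `s` contains an interval `[s, s + δ)`.
  have hnhds : ∀ (s : ℝ≥0) (A : Set ℝ≥0), A ∈ 𝓝[≥] s → ∃ δ > 0, ∀ q, s ≤ q → q < s + δ → q ∈ A := by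
    intro s A hA
    obtain ⟨b, hb, hsub⟩ := mem_nhdsGE_iff_exists_Ico_subset.1 hA
    refine ⟨b - s, tsub_pos_of_lt hb, fun q hq hqb ↦ hsub ⟨hq, ?_⟩⟩
    rwa [add_tsub_cancel_of_le (le_of_lt hb)] at hqb
  refine exists_congr fun s ↦ and_congr_right fun hs ↦ ⟨fun h ↦ ?_, fun h n ↦ ?_⟩
  · rw [Metric.mem_iff_infEDist_zero_of_closed hF]
    by_contra hne
    obtain ⟨n, hn⟩ := ENNReal.exists_inv_nat_lt hne
    obtain ⟨m, hm⟩ := h n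
    have hn' : (n + 1 : ℝ≥0∞)⁻¹ < Metric.infEDist (v s) F :=
      lt_of_le_of_lt (ENNReal.inv_le_inv.2 le_self_add) hn
    obtain ⟨δ, hδ, hq⟩ := hnhds s _ ((hcont s).eventually (lt_mem_nhds hn'))
    obtain ⟨k, hk, hk'⟩ := hu s hs (min δ (1 / (m + 1))) (by positivity)
    exact absurd (hm k hk (hk'.trans_le (by gcongr; exact min_le_right _ _)))
      (not_le.2 (hq _ hk.le (hk'.trans_le (by gcongr; exact min_le_left _ _))))
  · have hpos : Metric.infEDist (v s) F < (n + 1 : ℝ≥0∞)⁻¹ := by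
      rw [(Metric.mem_iff_infEDist_zero_of_closed hF).1 h]
      exact ENNReal.inv_pos.2 (by finiteness)
    obtain ⟨δ, hδ, hq⟩ := hnhds s _ ((hcont s).eventually (gt_mem_nhds hpos))
    obtain ⟨m, hm⟩ := exists_nat_one_div_lt hδ
    exact ⟨m, fun k hk hk' ↦ (hq _ hk.le (hk'.trans (by gcongr))).le⟩

theorem lt_exitTime_iff {d : ℕ} {U : Set (EuclideanSpace ℝ (Fin d))} (hU : IsOpen U)
    {v : ℝ≥0 → EuclideanSpace ℝ (Fin d)} (hv : ∀ s, ContinuousWithinAt v (Set.Ici s) s)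
    (h0 : v 0 ∈ U) (t : ℝ≥0) : (t : ℝ≥0∞) < exitTime U v ↔ ∀ s ≤ t, v s ∈ U := by
  constructor
  · intro h s hs
    by_contra hne
    have hs0 : 0 < s := pos_iff_ne_zero.2 fun h ↦ hne (h ▸ h0)
    exact absurd (h.trans_le (iInf₂_le s ⟨hs0, hne⟩)) (not_lt.2 (ENNReal.coe_le_coe.2 hs))
  · intro h
    -- By right continuity the path stays in `U` for a while after `t`.
    obtain ⟨b, hb, hsub⟩ := mem_nhdsGE_iff_exists_Ico_subset.1
      ((hv t).preimage_mem_nhdsWithin (hU.mem_nhds (h t le_rfl)))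
    refine lt_of_lt_of_le (ENNReal.coe_lt_coe.2 hb) (le_iInf₂ fun s hs ↦ ENNReal.coe_le_coe.2 ?_)
    by_contra hsb
    rcases le_total s t with hst | hst
    · exact hs.2 (h s hst)
    · exact hs.2 (hsub ⟨hst, not_le.1 hsb⟩)

section Comparison

variable {d : ℕ} {S S' : Type*} [MeasurableSpace S] [MeasurableSpace S'] {P : Measure S}
  {P' : Measure S'} [IsProbabilityMeasure P] [IsProbabilityMeasure P']
  {X : ℝ≥0 → S → EuclideanSpace ℝ (Fin d)} {Y : ℝ≥0 → S' → EuclideanSpace ℝ (Fin d)} {c : ℝ}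

/-- Survival is almost surely the event that the path sampled at the times `u k` avoids
`hittingPaths`. -/
theorem IsLevyProcess.measure_lt_exitTime (hX : IsLevyProcess X P)
    {U : Set (EuclideanSpace ℝ (Fin d))} (hU : IsOpen U) {x : EuclideanSpace ℝ (Fin d)}
    (hx : x ∈ U) {u : ℕ → ℝ≥0} {t : ℝ≥0} (hu : ∀ s ≤ t, ∀ δ > 0, ∃ k, s < u k ∧ u k < s + δ) :
    P {ω | (t : ℝ≥0∞) < exitTime U (fun s ↦ x + X s ω)}
      = (P.map fun ω k ↦ X (u k) ω) ((fun w k ↦ x + w k) ⁻¹' hittingPaths Uᶜ u t)ᶜ := by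
  have hm := hX.measurable
  have : IsProbabilityMeasure (P.map fun ω k ↦ X (u k) ω) :=
    Measure.isProbabilityMeasure_map (by fun_prop)
  have hA : AnalyticSet ((fun (w : ℕ → EuclideanSpace ℝ (Fin d)) k ↦ x + w k) ⁻¹'
      hittingPaths Uᶜ u t) := (analyticSet_hittingPaths Uᶜ u t).preimage (by fun_prop)
  rw [Measure.map_apply₀ (by fun_prop) (hA.nullMeasurableSet _).compl]
  refine measure_congr ?_
  filter_upwards [hX.start_zero, hX.rightCts_leftLim] with ω hω hω'
  have hv : ∀ s, ContinuousWithinAt (fun s ↦ x + X s ω) (Set.Ici s) s :=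
    fun s ↦ continuousWithinAt_const.add (hω' s).1
  refine propext ?_
  change (t : ℝ≥0∞) < exitTime U (fun s ↦ x + X s ω) ↔
    ¬ (fun k ↦ x + X (u k) ω) ∈ hittingPaths Uᶜ u t
  rw [lt_exitTime_iff hU hv (by simpa [hω] using hx),
    mem_hittingPaths_iff hU.isClosed_compl hu hv]
  simp

/-- The survival probabilities of two Lévy processes with comparable one-dimensional laws differ by
`O(t)`, uniformly in the starting point. -/
theorem IsLevyProcess.measure_lt_exitTime_le_add (hX : IsLevyProcess X P)
    (hY : IsLevyProcess Y P') (hc : 0 ≤ c)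
    (h : ∀ t : ℝ≥0, ∃ ζ : Measure (EuclideanSpace ℝ (Fin d)), IsProbabilityMeasure ζ ∧
      ENNReal.ofReal (Real.exp (-(t * c))) • P.map (X t) ≤ ζ ∧
      ENNReal.ofReal (Real.exp (-(t * c))) • P'.map (Y t) ≤ ζ)
    {U : Set (EuclideanSpace ℝ (Fin d))} (hU : IsOpen U) {x : EuclideanSpace ℝ (Fin d)}
    (hx : x ∈ U) {t : ℝ≥0} (ht : 0 < t) :
    P {ω | (t : ℝ≥0∞) < exitTime U (fun s ↦ x + X s ω)}
      ≤ P' {ω | (t : ℝ≥0∞) < exitTime U (fun s ↦ x + Y s ω)} + ENNReal.ofReal (4 * c * t) := by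
  have hXm := hX.measurable
  have hYm := hY.measurable
  -- Right continuity at `t` needs sampling times after `t`; going up to `2 t` costs only a factor.
  let u : ℕ → ℝ≥0 := fun k ↦ min (2 * t) (TopologicalSpace.denseSeq ℝ≥0 k)
  have hu : ∀ s ≤ t, ∀ δ > 0, ∃ k, s < u k ∧ u k < s + δ := by
    intro s hs δ hδ
    have hst : s < 2 * t := hs.trans_lt (lt_mul_left ht one_lt_two)
    obtain ⟨k, hk⟩ := (TopologicalSpace.denseRange_denseSeq ℝ≥0).exists_mem_open
      (isOpen_Ioo (a := s) (b := min (2 * t) (s + δ)))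
      (Set.nonempty_Ioo.2 (lt_min hst (lt_add_of_pos_right s hδ)))
    exact ⟨k, lt_min hst hk.1, (min_le_right _ _).trans_lt (hk.2.trans_le (min_le_right _ _))⟩
  rw [hX.measure_lt_exitTime hU hx hu, hY.measure_lt_exitTime hU hx hu]
  set A : Set (ℕ → EuclideanSpace ℝ (Fin d)) :=
    ((fun w k ↦ x + w k) ⁻¹' hittingPaths Uᶜ u t) with hA_def
  set μ := P.map fun ω k ↦ X (u k) ω with hμ
  set μ' := P'.map fun ω k ↦ Y (u k) ω with hμ'
  have : IsProbabilityMeasure μ := Measure.isProbabilityMeasure_map (by fun_prop)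
  have : IsProbabilityMeasure μ' := Measure.isProbabilityMeasure_map (by fun_prop)
  have hA : AnalyticSet A := (analyticSet_hittingPaths Uᶜ u t).preimage (by fun_prop)
  obtain ⟨B, -, hB, hBA⟩ :=
    (hA.nullMeasurableSet (μ + μ')).compl.exists_measurable_subset_ae_eq
  have hμB : μ B = μ Aᶜ := measure_congr (hBA.filter_mono (ae_mono (Measure.le_add_right le_rfl)))
  have hμB' : μ' B = μ' Aᶜ :=
    measure_congr (hBA.filter_mono (ae_mono (Measure.le_add_left le_rfl)))
  have hclose := hX.abs_measureReal_map_sub_le hY hc h u (r := 2 * t)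
    (fun k ↦ min_le_left _ _) hB
  rw [← hμ, ← hμ', abs_le] at hclose
  rw [← hμB, ← hμB', ← ofReal_measureReal, ← ofReal_measureReal,
    ← ENNReal.ofReal_add measureReal_nonneg (by positivity)]
  refine ENNReal.ofReal_le_ofReal ?_
  have := hclose.2
  push_cast at this
  linarith

theorem spectralHeatContent_le_add (hX : IsLevyProcess X P)
    (hY : IsLevyProcess Y P') (hc : 0 ≤ c)
    (h : ∀ t : ℝ≥0, ∃ ζ : Measure (EuclideanSpace ℝ (Fin d)), IsProbabilityMeasure ζ ∧
      ENNReal.ofReal (Real.exp (-(t * c))) • P.map (X t) ≤ ζ ∧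
      ENNReal.ofReal (Real.exp (-(t * c))) • P'.map (Y t) ≤ ζ)
    {U : Set (EuclideanSpace ℝ (Fin d))} (hU : IsOpen U) (hUfin : volume U < ∞) {t : ℝ≥0}
    (ht : 0 < t) :
    spectralHeatContent X P U t
      ≤ spectralHeatContent Y P' U t + 4 * c * volume.real U * t := by
  have hfin : ∫⁻ x in U, P' {ω | (t : ℝ≥0∞) < exitTime U (fun s ↦ x + Y s ω)} ≠ ∞ := by
    refine ne_top_of_le_ne_top hUfin.ne ((lintegral_mono fun _ ↦ prob_le_one).trans ?_)
    simp
  -- The error term is constant in `x`, so the survival probabilities, as functions of `x`, need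
  -- not be measurable for the integral of the sum to split.
  have hle : ∫⁻ x in U, P {ω | (t : ℝ≥0∞) < exitTime U (fun s ↦ x + X s ω)}
      ≤ (∫⁻ x in U, P' {ω | (t : ℝ≥0∞) < exitTime U (fun s ↦ x + Y s ω)})
        + ENNReal.ofReal (4 * c * t) * volume U := by
    refine (setLIntegral_mono' hU.measurableSet fun x hx ↦
      hX.measure_lt_exitTime_le_add hY hc h hU hx ht).trans ?_
    rw [lintegral_add_right _ measurable_const, setLIntegral_const]
  have hfin' : ENNReal.ofReal (4 * c * t) * volume U ≠ ∞ := by finiteness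
  have := ENNReal.toReal_mono (ENNReal.add_ne_top.2 ⟨hfin, hfin'⟩) hle
  rw [ENNReal.toReal_add hfin hfin', ENNReal.toReal_mul, ENNReal.toReal_ofReal (by positivity)]
    at this
  calc spectralHeatContent X P U t ≤ _ := this
    _ = _ := by rw [spectralHeatContent, Measure.real]; ring

end Comparison

theorem mainTheorem6 {d : ℕ}
    {S : Type*} [MeasurableSpace S] (P : Measure S) [IsProbabilityMeasure P]
    {S' : Type*} [MeasurableSpace S'] (P' : Measure S') [IsProbabilityMeasure P']
    (X : ℝ≥0 → S → EuclideanSpace ℝ (Fin d)) (Y : ℝ≥0 → S' → EuclideanSpace ℝ (Fin d))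
    (A : Matrix (Fin d) (Fin d) ℝ) (γX γY : EuclideanSpace ℝ (Fin d))
    (νX νY : Measure (EuclideanSpace ℝ (Fin d)))
    (hX : IsLevyProcessWithTriplet X P A γX νX)
    (hY : IsLevyProcessWithTriplet Y P' A γY νY)
    (σ : SignedMeasure (EuclideanSpace ℝ (Fin d)))
    (hσ : IsSignedDifference σ νX νY)
    (hγ : γX - γY = smallJumpMean σ)
    (Ω : Set (EuclideanSpace ℝ (Fin d))) (hΩ : IsOpen Ω) (hΩfin : volume Ω < ∞)
    (f : ℝ≥0 → ℝ) (hf : ∀ᶠ t in 𝓝[>] (0 : ℝ≥0), f t ≠ 0)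
    (hft : Tendsto (fun t : ℝ≥0 ↦ (t : ℝ) / f t) (𝓝[>] 0) (𝓝 0))
    (C : EReal)
    (hC : Tendsto
      (fun t : ℝ≥0 ↦ (((volume.real Ω - spectralHeatContent Y P' Ω t) / f t : ℝ) : EReal))
      (𝓝[>] 0) (𝓝 C)) :
    Tendsto
      (fun t : ℝ≥0 ↦ (((volume.real Ω - spectralHeatContent X P Ω t) / f t : ℝ) : EReal))
      (𝓝[>] 0) (𝓝 C) := by
  have hdom := exists_isProbabilityMeasure_smul_map_le hX hY hσ hγ
  set c := σ.totalVariation.real Set.univ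
  have hc : 0 ≤ c := measureReal_nonneg
  have hbound : ∀ t : ℝ≥0, 0 < t →
      |spectralHeatContent Y P' Ω t - spectralHeatContent X P Ω t|
        ≤ 4 * c * volume.real Ω * t := by
    intro t ht
    have h1 := spectralHeatContent_le_add hX.isLevyProcess hY.isLevyProcess hc hdom hΩ hΩfin ht
    have h2 := spectralHeatContent_le_add hY.isLevyProcess hX.isLevyProcess hc
      (fun s ↦ (hdom s).imp fun ζ h ↦ ⟨h.1, h.2.2, h.2.1⟩) hΩ hΩfin ht
    rw [abs_sub_le_iff]
    constructor <;> linarith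
  have hdiff : Tendsto (fun t : ℝ≥0 ↦
      (spectralHeatContent Y P' Ω t - spectralHeatContent X P Ω t) / f t) (𝓝[>] 0) (𝓝 0) := by
    have hlim := hft.norm.const_mul (4 * c * volume.real Ω)
    rw [norm_zero, mul_zero] at hlim
    refine squeeze_zero_norm' ?_ hlim
    filter_upwards [self_mem_nhdsWithin] with t ht
    rw [norm_div, norm_div, Real.norm_eq_abs, Real.norm_of_nonneg t.coe_nonneg, ← mul_div_assoc]
    exact div_le_div_of_nonneg_right (hbound t ht) (norm_nonneg _)
  have hsum := (EReal.continuousAt_add (p := (C, ((0 : ℝ) : EReal)))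
    (Or.inr (EReal.coe_ne_bot 0)) (Or.inr (EReal.coe_ne_top 0))).tendsto.comp
      (hC.prodMk_nhds ((continuous_coe_real_ereal.tendsto 0).comp hdiff))
  rw [EReal.coe_zero, add_zero] at hsum
  refine hsum.congr fun t ↦ ?_
  simp only [Function.comp_apply]
  rw [← EReal.coe_add, ← add_div, sub_add_sub_cancel]
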